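/- Consider the Gaussian Y-channel with three users, a relay, real channel gains $h_1,h_2,h_3$ and power $P\ge 0$. For every ordered pair of distinct users $(j,k)$, user $j$ has a message $m_{jk}$ for user $k$; the six messages are independent, $m_{jk}$ being uniform on $\{1,\dots,\lfloor 2^{nR_{jk}}\rfloor\}$. At time $i\in\{1,\dots,n\}$ the relay receives $y_{ri}=h_1x_{1i}+h_2x_{2i}+h_3x_{3i}+z_{ri}$ and user $j$ receives $y_{ji}=h_jx_{ri}+z_{ji}$, where all noise variables $z_{ri},z_{ji}$ are independent, standard Gaussian, and independent of the messages. A code of block length $n$ with non-restricted encoding consists of (measurable) encoders $x_{ji}=f_{ji}(m_{jk},m_{jl},y_j^{i-1})$ at the users, where $y_j^{i-1}=(y_{j1},\dots,y_{j,i-1})$, relay encoders $x_{ri}=f_{ri}(y_r^{i-1})$, and decoders $(\hat m_{kj},\hat m_{lj})=g_j(y_j^n,m_{jk},m_{jl})$, for $\{j,k,l\}=\{1,2,3\}$, such that $\frac1n\sum_{i=1}^n\mathbb E[X_{ji}^2]\le P$ for $j=1,2,3$ and $\frac1n\sum_{i=1}^n\mathbb E[X_{ri}^2]\le P$. A rate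 tuple $\vec R=(R_{12},R_{13},R_{21},R_{23},R_{31},R_{32})\in\mathbb R_{\ge0}^6$ is achievable if there is a sequence of such codes, one for each block length $n$, for which the probability that some user decodes one of its two messages incorrectly tends to $0$ as $n\to\infty$. Let $C(x)=\frac12\log_2(1+x)$. If $\vec R$ is achievable, then $$R_{kj}+R_{lj}+R_{kl}\le C\big((|h_k|+|h_l|)^2P\big)$$ for all distinct $j,k,l\in\{1,2,3\}$. -/

import Mathlib

open MeasureTheory ProbabilityTheory Filter Topology
open scoped ENNReal

noncomputable section

namespace YChannel

/-- The two users other than user `j`. -/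
abbrev Other (j : Fin 3) : Type := {k : Fin 3 // k ≠ j}

/-- A vector of six rates; `R j k` is the rate `R_{jk}` of the message from user `j` to user `k`. -/
abbrev RateTuple : Type := (j : Fin 3) → Other j → ℝ

/-- The function `C(x) = (1/2) log₂ (1 + x)`, in bits. -/
def gaussianC (x : ℝ) : ℝ := 1 / 2 * Real.logb 2 (1 + x)

/-- The message set of the pair `(j, k)`: the integers between `1` and `2 ^ (n R_{jk})`
(relabelled to start from `0`). -/
abbrev MessageSet (R : RateTuple) (n : ℕ) (j : Fin 3) (k : Other j) : Type :=
  Fin ⌊(2 : ℝ) ^ ((n : ℝ) * R j k)⌋₊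

/-- The pair of messages that user `j` wants to send, one to each other user. -/
abbrev Outgoing (R : RateTuple) (n : ℕ) (j : Fin 3) : Type :=
  (k : Other j) → MessageSet R n j k

/-- The pair of messages that user `j` wants to decode, one from each other user. -/
abbrev Incoming (R : RateTuple) (n : ℕ) (j : Fin 3) : Type :=
  (k : Other j) → MessageSet R n k.1 ⟨j, k.2.symm⟩

/-- The vector of all six messages. -/
abbrev Messages (R : RateTuple) (n : ℕ) : Type := (j : Fin 3) → Outgoing R n j

/-- The messages intended for user `j`. -/
def intendedFor {R : RateTuple} {n : ℕ} (m : Messages R n) (j : Fin 3) : Incoming R n j :=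
  fun k => m k.1 ⟨j, k.2.symm⟩

/-- Noise realisations over `n` channel uses: at the three users, and at the relay. -/
abbrev Noise (n : ℕ) : Type := (Fin 3 → Fin n → ℝ) × (Fin n → ℝ)

/-- A code of rate tuple `R` and block length `n` with non-restricted (feedback-dependent)
encoding. Time instants are `i : Fin n`, and `Fin i → ℝ` is the space of the symbols
received strictly before time `i`. -/
structure Code (R : RateTuple) (n : ℕ) where
  /-- `x_{ji}` as a function of the messages of user `j` and of its past received symbols -/
  enc : (j : Fin 3) → (i : Fin n) → Outgoing R n j → (Fin i → ℝ) → ℝ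
  /-- `x_{ri}` as a function of the past received symbols of the relay -/
  relayEnc : (i : Fin n) → (Fin i → ℝ) → ℝ
  /-- the decoder of user `j`, which sees its received sequence and its own messages -/
  dec : (j : Fin 3) → (Fin n → ℝ) → Outgoing R n j → Incoming R n j
  measurable_enc : ∀ j i w, Measurable (enc j i w)
  measurable_relayEnc : ∀ i, Measurable (relayEnc i)
  measurable_dec : ∀ j w, Measurable (fun y => dec j y w)

namespace Code

variable {R : RateTuple} {n : ℕ}

/-- The symbols received at time `i` by the three users (first component) and by the relay
(second component), when the messages are `m`, the noise is `z` and the channel gains are `h`: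
`y_{ji} = h_j x_{ri} + z_{ji}` and `y_{ri} = h_1 x_{1i} + h_2 x_{2i} + h_3 x_{3i} + z_{ri}`. -/
def received (c : Code R n) (h : Fin 3 → ℝ) (m : Messages R n) (z : Noise n) (i : Fin n) :
    (Fin 3 → ℝ) × ℝ :=
  (fun j => h j * c.relayEnc i (fun t => (received c h m z ⟨t, t.2.trans i.2⟩).2) + z.1 j i,
    (∑ j, h j * c.enc j i (m j) (fun t => (received c h m z ⟨t, t.2.trans i.2⟩).1 j)) + z.2 i)
termination_by i.1
decreasing_by all_goals exact t.2

/-- The symbol `x_{ji}` transmitted by user `j` at time `i`. -/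
def userSymbol (c : Code R n) (h : Fin 3 → ℝ) (m : Messages R n) (z : Noise n)
    (j : Fin 3) (i : Fin n) : ℝ :=
  c.enc j i (m j) (fun t => (c.received h m z ⟨t, t.2.trans i.2⟩).1 j)

/-- The symbol `x_{ri}` transmitted by the relay at time `i`. -/
def relaySymbol (c : Code R n) (h : Fin 3 → ℝ) (m : Messages R n) (z : Noise n)
    (i : Fin n) : ℝ :=
  c.relayEnc i (fun t => (c.received h m z ⟨t, t.2.trans i.2⟩).2)

/-- The estimates that user `j` makes of the two messages intended for it. -/
def estimate (c : Code R n) (h : Fin 3 → ℝ) (m : Messages R n) (z : Noise n) (j : Fin 3) :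
    Incoming R n j :=
  c.dec j (fun i => (c.received h m z i).1 j) (m j)

end Code

/-- The law of the noise: all components are independent standard Gaussian variables. -/
def noiseLaw (n : ℕ) : Measure (Noise n) :=
  (Measure.pi fun _ => Measure.pi fun _ => gaussianReal 0 1).prod
    (Measure.pi fun _ => gaussianReal 0 1)

/-- The joint law of the messages and the noise: the message vector is uniform on the product
of the message sets, and independent of the noise. -/
def jointLaw (R : RateTuple) (n : ℕ) : Measure (Messages R n × Noise n) :=
  (uniformOn (Set.univ : Set (Messages R n))).prod (noiseLaw n)

/-- The average power constraints `(1/n) ∑ i, E[X_i ^ 2] ≤ P` at the three users and at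
the relay. -/
def Code.PowerConstraint {R : RateTuple} {n : ℕ} (c : Code R n) (h : Fin 3 → ℝ) (P : ℝ) : Prop :=
  (∀ j, (n : ℝ≥0∞)⁻¹ * ∑ i, ∫⁻ ω, ENNReal.ofReal (c.userSymbol h ω.1 ω.2 j i ^ 2) ∂(jointLaw R n)
      ≤ ENNReal.ofReal P) ∧
  (n : ℝ≥0∞)⁻¹ * ∑ i, ∫⁻ ω, ENNReal.ofReal (c.relaySymbol h ω.1 ω.2 i ^ 2) ∂(jointLaw R n)
      ≤ ENNReal.ofReal P

/-- The average probability that some user decodes one of its messages wrongly. -/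
def Code.errorProb {R : RateTuple} {n : ℕ} (c : Code R n) (h : Fin 3 → ℝ) : ℝ≥0∞ :=
  jointLaw R n {ω | ∃ j, c.estimate h ω.1 ω.2 j ≠ intendedFor ω.1 j}

/-- Achievability of a rate tuple over the non-restricted Gaussian Y-channel with channel
gains `h` and power `P`. -/
def Achievable (h : Fin 3 → ℝ) (P : ℝ) (R : RateTuple) : Prop :=
  (∀ j k, 0 ≤ R j k) ∧
  ∃ c : (n : ℕ) → Code R n, (∀ n, (c n).PowerConstraint h P) ∧
    Tendsto (fun n => (c n).errorProb h) atTop (𝓝 0)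

end YChannel

end

namespace YChannel

/-! The proof is a cut-set argument with a genie, carried out by a change of measure instead of
entropies and Fano's inequality. Fix `j` and set `v = 1 + (|h k| + |h l|) ^ 2 * P`. Let `μ` be the
true law and `Q` the law with density `likelihood` with respect to `μ`: messages and user noise keep
their law, but the relay's signal minus user `j`'s contribution becomes i.i.d. `N(0, v)`, as if the
other two users were replaced by noise.

Given the user noise `a`, the relay sequence `y` determines what every user receives. Under `Q` the
law of `y` given `a` and the messages depends only on the messages of `j`. If all users decode
correctly, then `a`, `y`, the messages of `j` and the genie message from `l` to `k` determine
everything: decoding as `j` completes the messages of `l`, and then decoding as `l` completes those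
of `k` (`injOn_correct`). So `Q` gives the correct event mass at most `1 / M`, where `M` counts the
triples of messages in the bound (`lintegral_correct_le`).

On the other hand, causality and the power constraint bound the total second moment of the residuals
by `n * v`, so the divergence of `μ` from `Q` is at most `n / 2 * log v`
(`le_integral_log_likelihood`). A tangent-line bound for the logarithm compares the two laws on the
correct event and gives `(1 - error) * log M ≤ log 2 + n / 2 * log v` (`mul_log_card_le`). Dividing
by `n * log 2` and letting `n` tend to infinity gives the theorem. -/

/-! ### Gaussian densities and causal shifts of `Fin n → ℝ` -/

theorem lintegral_volume_prod_eq_prod {n : ℕ} (f : Fin n → ℝ → ℝ≥0∞) (hf : ∀ i, Measurable (f i)) :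
    ∫⁻ x : Fin n → ℝ, ∏ i, f i (x i) = ∏ i, ∫⁻ x, f i x := by
  induction n with
  | zero => simp [volume_pi]
  | succ n ih =>
    have e := (volume_preserving_piFinSuccAbove (fun _ : Fin (n + 1) => ℝ) 0).symm
    rw [← e.lintegral_comp (by fun_prop)]
    simp only [Fin.prod_univ_succ, MeasurableEquiv.piFinSuccAbove_symm_apply,
      Fin.insertNthEquiv_apply, Fin.insertNth_zero', Fin.cons_zero, Fin.cons_succ]
    rw [Measure.volume_eq_prod,
      lintegral_prod_mul (g := fun x : Fin n → ℝ => ∏ i, f i.succ (x i)) (hf 0).aemeasurable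
        (Finset.measurable_prod _ fun i _ =>
          (hf i.succ).comp (measurable_pi_apply i)).aemeasurable, ih _ fun i => hf i.succ]

theorem pi_gaussianReal_eq_withDensity (n : ℕ) {v : NNReal} (hv : v ≠ 0) :
    (Measure.pi fun _ : Fin n => gaussianReal 0 v) =
      volume.withDensity fun x => ∏ i, gaussianPDF 0 v (x i) := by
  refine Measure.pi_eq fun s hs => ?_
  rw [withDensity_apply _ (MeasurableSet.univ_pi hs),
    ← lintegral_indicator (MeasurableSet.univ_pi hs)]
  have : ∀ x : Fin n → ℝ, (Set.univ.pi s).indicator (fun x => ∏ i, gaussianPDF 0 v (x i)) x =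
      ∏ i, (s i).indicator (gaussianPDF 0 v) (x i) := by
    intro x
    by_cases hx : x ∈ Set.univ.pi s
    · rw [Set.indicator_of_mem hx]
      exact Finset.prod_congr rfl fun i _ => (Set.indicator_of_mem (hx i trivial) _).symm
    · rw [Set.indicator_of_notMem hx]
      simp only [Set.mem_pi, Set.mem_univ, true_imp_iff, not_forall] at hx
      obtain ⟨i, hi⟩ := hx
      exact (Finset.prod_eq_zero (Finset.mem_univ i) (Set.indicator_of_notMem hi _)).symm
  simp_rw [this]
  rw [lintegral_volume_prod_eq_prod _ fun i => (measurable_gaussianPDF 0 v).indicator (hs i)]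
  refine Finset.prod_congr rfl fun i _ => ?_
  rw [lintegral_indicator (hs i), gaussianReal_apply 0 hv]

theorem lintegral_prod_gaussianPDF (n : ℕ) {v : NNReal} (hv : v ≠ 0) :
    ∫⁻ x : Fin n → ℝ, ∏ i, gaussianPDF 0 v (x i) = 1 := by
  rw [lintegral_volume_prod_eq_prod _ fun _ => measurable_gaussianPDF 0 v]
  simp [lintegral_gaussianPDF_eq_one 0 hv]

/-- Subtracting from each coordinate a function of the preceding coordinates preserves volume. -/
theorem measurePreserving_sub_causal {n : ℕ} (g : (i : Fin n) → (Fin i → ℝ) → ℝ)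
    (hg : ∀ i, Measurable (g i)) :
    MeasurePreserving (fun (y : Fin n → ℝ) i => y i - g i fun t => y ⟨t, t.2.trans i.2⟩)
      volume volume := by
  induction n with
  | zero =>
    convert MeasurePreserving.id (volume : Measure (Fin 0 → ℝ)) using 2
  | succ n ih =>
    have e := volume_preserving_piFinSuccAbove (fun _ : Fin (n + 1) => ℝ) (Fin.last n)
    have h1 := ih (fun i => g i.castSucc) fun i => hg i.castSucc
    have h2 := h1.skew_product (μc := (volume : Measure ℝ)) (μd := volume)
      (g := fun (y : Fin n → ℝ) x => x - g (Fin.last n) y)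
      (measurable_snd.sub ((hg (Fin.last n)).comp measurable_fst))
      (ae_of_all _ fun y => (measurePreserving_sub_right volume (g (Fin.last n) y)).map_eq)
    -- `skew_product` shears the second factor, while `piFinSuccAbove` puts the isolated coordinate
    -- first; hence the swaps.
    have h3 := (e.symm.comp Measure.measurePreserving_swap).comp
      (h2.comp (Measure.measurePreserving_swap.comp e))
    refine (congrArg (MeasurePreserving · volume volume) ?_).mpr h3
    funext y i
    refine Fin.lastCases ?_ (fun i => ?_) i
    · simp [MeasurableEquiv.piFinSuccAbove, Fin.insertNthEquiv]
      rfl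
    · simp [MeasurableEquiv.piFinSuccAbove, Fin.insertNthEquiv]
      rfl

theorem measurePreserving_update_neg {n : ℕ} (i : Fin n) :
    MeasurePreserving (fun x : Fin n → ℝ => Function.update x i (-x i))
      (Measure.pi fun _ => gaussianReal 0 1) (Measure.pi fun _ => gaussianReal 0 1) := by
  have := measurePreserving_pi (fun _ : Fin n => gaussianReal 0 1) (fun _ => gaussianReal 0 1)
    (f := fun k x => if k = i then -x else x) (fun k => by
      by_cases hk : k = i
      · simp only [hk, if_true]
        exact ⟨measurable_neg, by simpa using gaussianReal_map_neg (μ := 0) (v := 1)⟩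
      · simp only [hk, if_false]
        exact MeasurePreserving.id _)
  convert this using 1
  funext x k
  by_cases hk : k = i
  · subst hk; simp
  · simp [hk]

/-! ### The relay sequence as a coordinate in place of the relay noise -/

namespace Code

variable {R : RateTuple} {n : ℕ} (c : Code R n) (h : Fin 3 → ℝ)

theorem measurable_received (m : Messages R n) (i : Fin n) :
    Measurable fun z => c.received h m z i := by
  induction i using WellFoundedLT.induction with
  | ind i ih =>
    have h2 : ∀ z, c.received h m z i = _ := fun z => by rw [received]
    simp_rw [h2]
    refine Measurable.prodMk (measurable_pi_iff.2 fun j => ?_) ?_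
    · refine (((c.measurable_relayEnc i).comp (measurable_pi_iff.2 fun t => ?_)).const_mul _).add
        (by fun_prop)
      exact (ih ⟨t, t.2.trans i.2⟩ t.2).snd
    · refine (Finset.measurable_sum _ fun j _ => ?_).add (by fun_prop)
      refine ((c.measurable_enc j i (m j)).comp (measurable_pi_iff.2 fun t => ?_)).const_mul _
      exact (measurable_pi_apply j).comp (ih ⟨t, t.2.trans i.2⟩ t.2).fst

theorem measurable_userSymbol (j : Fin 3) (i : Fin n) :
    Measurable fun ω : Messages R n × Noise n => c.userSymbol h ω.1 ω.2 j i := by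
  refine measurable_from_prod_countable_right fun m => ?_
  refine (c.measurable_enc j i (m j)).comp (measurable_pi_iff.2 fun t => ?_)
  exact (measurable_pi_apply j).comp (c.measurable_received h m _).fst

theorem measurable_estimate (m : Messages R n) (j : Fin 3) :
    Measurable fun z => c.estimate h m z j :=
  (c.measurable_dec j (m j)).comp (measurable_pi_iff.2 fun i =>
    (measurable_pi_apply j).comp (c.measurable_received h m i).fst)

theorem received_congr (m : Messages R n) {a : Fin 3 → Fin n → ℝ} {z z' : Fin n → ℝ} (i : Fin n)
    (hz : ∀ t ≤ i, z t = z' t) : c.received h m (a, z) i = c.received h m (a, z') i := by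
  induction i using WellFoundedLT.induction with
  | ind i ih =>
    have h2 : ∀ t : Fin i, c.received h m (a, z) ⟨t, t.2.trans i.2⟩ =
        c.received h m (a, z') ⟨t, t.2.trans i.2⟩ := fun t =>
      ih _ t.2 fun s hs => hz s (hs.trans (le_of_lt t.2))
    rw [received, received]
    simp only [h2, hz i le_rfl]

theorem userSymbol_congr (m : Messages R n) {a : Fin 3 → Fin n → ℝ} {z z' : Fin n → ℝ} (j : Fin 3)
    (i : Fin n) (hz : ∀ t < i, z t = z' t) :
    c.userSymbol h m (a, z) j i = c.userSymbol h m (a, z') j i := by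
  unfold userSymbol
  congr 1
  funext t
  rw [c.received_congr h m _ fun s hs => hz s (lt_of_le_of_lt hs t.2)]

/-- The sequence received by user `j` when the relay receives `y` and the user noise is `a`. -/
def userReceived (a : Fin 3 → Fin n → ℝ) (y : Fin n → ℝ) (j : Fin 3) (i : Fin n) : ℝ :=
  h j * c.relayEnc i (fun t => y ⟨t, t.2.trans i.2⟩) + a j i

/-- The symbol sent by user `j` with messages `w` as a function of the past received symbols of
the relay, when the user noise is `a`. -/
def symbolOfRelay (a : Fin 3 → Fin n → ℝ) (j : Fin 3) (w : Outgoing R n j) (i : Fin n)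
    (p : Fin i → ℝ) : ℝ :=
  c.enc j i w fun t =>
    h j * c.relayEnc ⟨t, t.2.trans i.2⟩ (fun s => p ⟨s, s.2.trans t.2⟩) + a j ⟨t, t.2.trans i.2⟩

theorem measurable_symbolOfRelay (a : Fin 3 → Fin n → ℝ) (j : Fin 3) (w : Outgoing R n j)
    (i : Fin n) : Measurable (c.symbolOfRelay h a j w i) := by
  refine (c.measurable_enc j i w).comp (measurable_pi_iff.2 fun t => ?_)
  refine Measurable.add_const (Measurable.const_mul ?_ _) _
  exact (c.measurable_relayEnc _).comp (measurable_pi_iff.2 fun s => measurable_pi_apply _)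

/-- The relay noise that makes the relay receive `y`. -/
def relayNoise (m : Messages R n) (a : Fin 3 → Fin n → ℝ) (y : Fin n → ℝ) (i : Fin n) : ℝ :=
  y i - ∑ j, h j * c.symbolOfRelay h a j (m j) i fun t => y ⟨t, t.2.trans i.2⟩

theorem measurePreserving_relayNoise (m : Messages R n) (a : Fin 3 → Fin n → ℝ) :
    MeasurePreserving (c.relayNoise h m a) volume volume :=
  measurePreserving_sub_causal
    (fun i p => ∑ j, h j * c.symbolOfRelay h a j (m j) i p) fun i =>
      Finset.measurable_sum _ fun j _ => (c.measurable_symbolOfRelay h a j (m j) i).const_mul _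

/-- Feedback causes no circularity: once the relay sequence and the user noise are fixed, all
received sequences are explicit and free of the messages. -/
theorem received_relayNoise (m : Messages R n) (a : Fin 3 → Fin n → ℝ) (y : Fin n → ℝ)
    (i : Fin n) :
    c.received h m (a, c.relayNoise h m a y) i =
      (fun j => c.userReceived h a y j i, y i) := by
  induction i using WellFoundedLT.induction with
  | ind i ih =>
    have h2 : ∀ t : Fin i, c.received h m (a, c.relayNoise h m a y) ⟨t, t.2.trans i.2⟩ = _ :=
      fun t => ih _ t.2
    rw [received]
    simp only [h2]
    refine Prod.ext rfl ?_
    simp only [relayNoise, symbolOfRelay, userReceived]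
    ring

theorem userSymbol_relayNoise (m : Messages R n) (a : Fin 3 → Fin n → ℝ) (y : Fin n → ℝ)
    (j : Fin 3) (i : Fin n) :
    c.userSymbol h m (a, c.relayNoise h m a y) j i =
      c.symbolOfRelay h a j (m j) i fun t => y ⟨t, t.2.trans i.2⟩ := by
  simp only [userSymbol, received_relayNoise]
  rfl

end Code

/-! ### The joint law and the number of messages -/

theorem lintegral_jointLaw {R : RateTuple} {n : ℕ} [Nonempty (Messages R n)]
    {f : Messages R n × Noise n → ℝ≥0∞} (hf : Measurable f) :
    ∫⁻ ω, f ω ∂jointLaw R n =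
      (Fintype.card (Messages R n) : ℝ≥0∞)⁻¹ * ∑ m, ∫⁻ a, ∫⁻ z, f (m, (a, z))
        ∂(Measure.pi fun _ => gaussianReal 0 1)
        ∂(Measure.pi fun _ => Measure.pi fun _ => gaussianReal 0 1) := by
  have h1 : ∀ g : Messages R n → ℝ≥0∞, ∫⁻ m, g m ∂uniformOn (Set.univ : Set (Messages R n)) =
      (Fintype.card (Messages R n) : ℝ≥0∞)⁻¹ * ∑ m, g m := by
    intro g
    rw [uniformOn, ProbabilityTheory.cond, Measure.restrict_univ, lintegral_smul_measure,
      lintegral_count, tsum_fintype, Measure.count_univ, ENat.card_eq_coe_fintype_card,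
      smul_eq_mul, ENat.toENNReal_coe]
  have : SFinite (noiseLaw n) := by unfold noiseLaw; infer_instance
  rw [jointLaw, lintegral_prod _ hf.aemeasurable, h1]
  congr 1
  refine Finset.sum_congr rfl fun m _ => ?_
  have h2 : Measurable fun z => f (m, z) := hf.comp measurable_prodMk_left
  rw [noiseLaw, lintegral_prod _ h2.aemeasurable]

instance {R : RateTuple} {n : ℕ} [Nonempty (Messages R n)] :
    IsProbabilityMeasure (jointLaw R n) := by
  have : IsProbabilityMeasure (noiseLaw n) := by unfold noiseLaw; infer_instance
  have : IsProbabilityMeasure (uniformOn (Set.univ : Set (Messages R n))) :=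
    isProbabilityMeasure_uniformOn Set.finite_univ Set.univ_nonempty
  unfold jointLaw
  infer_instance

theorem prod_other {M : Type*} [CommMonoid M] {j k l : Fin 3} (hjk : j ≠ k) (hjl : j ≠ l)
    (hkl : k ≠ l) (f : Other j → M) : ∏ x, f x = f ⟨k, hjk.symm⟩ * f ⟨l, hjl.symm⟩ := by
  have : (Finset.univ : Finset (Other j)) = {⟨k, hjk.symm⟩, ⟨l, hjl.symm⟩} := by
    ext ⟨x, hx⟩
    simp only [Finset.mem_univ, Finset.mem_insert, Finset.mem_singleton, Subtype.mk.injEq, true_iff]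
    omega
  rw [this, Finset.prod_pair (by simpa using hkl)]

theorem univ_erase_eq {j k l : Fin 3} (hjk : j ≠ k) (hjl : j ≠ l) (hkl : k ≠ l) :
    Finset.univ.erase j = {k, l} := by
  ext x
  simp only [Finset.mem_erase, Finset.mem_univ, Finset.mem_insert, Finset.mem_singleton, and_true]
  omega

theorem card_messages (R : RateTuple) (n : ℕ) {j k l : Fin 3} (hjk : j ≠ k) (hjl : j ≠ l)
    (hkl : k ≠ l) :
    Fintype.card (Messages R n) =
      Fintype.card (MessageSet R n k ⟨j, hjk⟩) * Fintype.card (MessageSet R n l ⟨j, hjl⟩) *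
        Fintype.card (MessageSet R n k ⟨l, hkl.symm⟩) *
        Fintype.card (Outgoing R n j × MessageSet R n l ⟨k, hkl⟩) := by
  rw [Fintype.card_pi, ← Finset.mul_prod_erase _ _ (Finset.mem_univ j), univ_erase_eq hjk hjl hkl,
    Finset.prod_pair hkl, Fintype.card_prod]
  have hk : Fintype.card (Outgoing R n k) = _ := Fintype.card_pi
  have hl : Fintype.card (Outgoing R n l) = _ := Fintype.card_pi
  rw [hk, hl, prod_other hjk.symm hkl hjl, prod_other hjl.symm hkl.symm hjk]
  ring

/-! ### The change of measure and the probability of correct decoding under it -/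

namespace Code

variable {R : RateTuple} {n : ℕ} (c : Code R n) (h : Fin 3 → ℝ)

/-- What remains of the symbol received by the relay without the contribution of user `j`. -/
noncomputable def residual (j : Fin 3) (m : Messages R n) (z : Noise n) (i : Fin n) : ℝ :=
  ∑ k ∈ Finset.univ.erase j, h k * c.userSymbol h m z k i + z.2 i

/-- The density of the law under which the residuals of user `j` are independent centered Gaussian
of variance `v`, with respect to the law of the channel. -/
noncomputable def likelihood (j : Fin 3) (v : NNReal) (m : Messages R n) (z : Noise n) : ℝ :=
  ∏ i, (gaussianPDFReal 0 v (c.residual h j m z i) / gaussianPDFReal 0 1 (z.2 i))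

/-- The event that every user decodes correctly. -/
def correct : Set (Messages R n × Noise n) :=
  {ω | ∀ j, c.estimate h ω.1 ω.2 j = intendedFor ω.1 j}

theorem measurableSet_correct : MeasurableSet (c.correct h) := by
  rw [correct, Set.ofPred_forall]
  refine MeasurableSet.iInter fun j => ?_
  have h1 : Measurable fun ω : Messages R n × Noise n =>
      (c.estimate h ω.1 ω.2 j, intendedFor ω.1 j) := by
    refine measurable_from_prod_countable_right fun m => ?_
    exact (c.measurable_estimate h m j).prodMk (measurable_const (a := intendedFor m j))
  exact h1 (Set.to_countable {p : Incoming R n j × Incoming R n j | p.1 = p.2}).measurableSet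

theorem measurable_residual (j : Fin 3) (i : Fin n) :
    Measurable fun ω : Messages R n × Noise n => c.residual h j ω.1 ω.2 i := by
  refine (Finset.measurable_sum _ fun k _ => (c.measurable_userSymbol h k i).const_mul _).add ?_
  fun_prop

theorem measurable_likelihood (j : Fin 3) (v : NNReal) :
    Measurable fun ω : Messages R n × Noise n => c.likelihood h j v ω.1 ω.2 := by
  refine Finset.measurable_prod _ fun i _ => Measurable.div ?_ ?_
  · exact (measurable_gaussianPDFReal 0 v).comp (c.measurable_residual h j i)
  · exact (measurable_gaussianPDFReal 0 1).comp (by fun_prop)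

theorem likelihood_pos (j : Fin 3) {v : NNReal} (hv : v ≠ 0) (m : Messages R n) (z : Noise n) :
    0 < c.likelihood h j v m z :=
  Finset.prod_pos fun _ _ =>
    div_pos (gaussianPDFReal_pos _ _ _ hv) (gaussianPDFReal_pos _ _ _ one_ne_zero)

/-- The density of the relay sequence `y` when the residuals of user `j`, which sends the messages
`w`, are independent centered Gaussian of variance `v`, and the user noise is `a`. -/
noncomputable def relayDensity (j : Fin 3) (v : NNReal) (a : Fin 3 → Fin n → ℝ) (w : Outgoing R n j)
    (y : Fin n → ℝ) : ℝ≥0∞ :=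
  ∏ i, gaussianPDF 0 v (y i - h j * c.symbolOfRelay h a j w i fun t => y ⟨t, t.2.trans i.2⟩)

theorem measurable_relayDensity (j : Fin 3) (v : NNReal) (a : Fin 3 → Fin n → ℝ)
    (w : Outgoing R n j) : Measurable (c.relayDensity h j v a w) := by
  refine Finset.measurable_prod _ fun i _ => (measurable_gaussianPDF 0 v).comp ?_
  refine (measurable_pi_apply i).sub (Measurable.const_mul ?_ _)
  exact (c.measurable_symbolOfRelay h a j w i).comp (measurable_pi_iff.2 fun t =>
    measurable_pi_apply _)

theorem lintegral_relayDensity (j : Fin 3) {v : NNReal} (hv : v ≠ 0) (a : Fin 3 → Fin n → ℝ)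
    (w : Outgoing R n j) : ∫⁻ y, c.relayDensity h j v a w y = 1 := by
  have h1 := measurePreserving_sub_causal (fun i p => h j * c.symbolOfRelay h a j w i p) fun i =>
    (c.measurable_symbolOfRelay h a j w i).const_mul _
  have h2 : Measurable fun x : Fin n → ℝ => ∏ i, gaussianPDF 0 v (x i) :=
    Finset.measurable_prod _ fun i _ => (measurable_gaussianPDF 0 v).comp (measurable_pi_apply i)
  rw [← lintegral_prod_gaussianPDF n hv, ← h1.lintegral_comp h2]
  rfl

theorem residual_relayNoise (j : Fin 3) (m : Messages R n) (a : Fin 3 → Fin n → ℝ)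
    (y : Fin n → ℝ) (i : Fin n) :
    c.residual h j m (a, c.relayNoise h m a y) i =
      y i - h j * c.symbolOfRelay h a j (m j) i fun t => y ⟨t, t.2.trans i.2⟩ := by
  simp only [residual, userSymbol_relayNoise, relayNoise]
  rw [← Finset.add_sum_erase _ _ (Finset.mem_univ j)]
  ring

/-- The denominator of the likelihood cancels the density of the relay noise; the volume-preserving
substitution `z = relayNoise y` then turns the residuals into a function of `y`, `a` and `m j`
alone. The other messages survive only in `F`. -/
theorem lintegral_mul_likelihood (j : Fin 3) (v : NNReal) (m : Messages R n)
    (a : Fin 3 → Fin n → ℝ) {F : (Fin n → ℝ) → ℝ≥0∞} (hF : Measurable F) :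
    ∫⁻ z, F z * ENNReal.ofReal (c.likelihood h j v m (a, z))
        ∂(Measure.pi fun _ => gaussianReal 0 1) =
      ∫⁻ y, F (c.relayNoise h m a y) * c.relayDensity h j v a (m j) y := by
  have hD : Measurable fun z => ENNReal.ofReal (c.likelihood h j v m (a, z)) :=
    ((c.measurable_likelihood h j v).comp
      (measurable_prodMk_left.comp measurable_prodMk_left)).ennreal_ofReal
  have hr : Measurable fun z => ∏ i, gaussianPDF 0 v (c.residual h j m (a, z) i) :=
    Finset.measurable_prod _ fun i _ => (measurable_gaussianPDF 0 v).comp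
      ((c.measurable_residual h j i).comp (measurable_prodMk_left.comp measurable_prodMk_left))
  have hg : Measurable fun x : Fin n → ℝ => ∏ i, gaussianPDF 0 1 (x i) :=
    Finset.measurable_prod _ fun i _ => (measurable_gaussianPDF 0 1).comp (measurable_pi_apply i)
  rw [pi_gaussianReal_eq_withDensity n one_ne_zero]
  refine (lintegral_withDensity_eq_lintegral_mul _ hg (hF.mul hD)).trans ?_
  have h1 : ∀ z : Fin n → ℝ, ((fun x : Fin n → ℝ => ∏ i, gaussianPDF 0 1 (x i)) *
      (F * fun z => ENNReal.ofReal (c.likelihood h j v m (a, z)))) z =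
      F z * ∏ i, gaussianPDF 0 v (c.residual h j m (a, z) i) := by
    intro z
    simp only [Pi.mul_apply, likelihood]
    rw [ENNReal.ofReal_prod_of_nonneg fun i _ =>
      div_nonneg (gaussianPDFReal_nonneg _ _ _) (gaussianPDFReal_nonneg _ _ _),
      mul_left_comm, ← Finset.prod_mul_distrib]
    congr 1
    refine Finset.prod_congr rfl fun i _ => ?_
    rw [gaussianPDF, gaussianPDF, ← ENNReal.ofReal_mul (gaussianPDFReal_nonneg _ _ _),
      mul_div_cancel₀ _ (gaussianPDFReal_pos _ _ _ one_ne_zero).ne']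
  simp_rw [h1]
  refine ((c.measurePreserving_relayNoise h m a).lintegral_comp (hF.mul hr)).symm.trans ?_
  simp only [Pi.mul_apply, residual_relayNoise, relayDensity]

theorem lintegral_likelihood [Nonempty (Messages R n)] (j : Fin 3) {v : NNReal} (hv : v ≠ 0) :
    ∫⁻ ω, ENNReal.ofReal (c.likelihood h j v ω.1 ω.2) ∂jointLaw R n = 1 := by
  rw [lintegral_jointLaw (c.measurable_likelihood h j v).ennreal_ofReal]
  have h1 : ∀ m a, ∫⁻ z, ENNReal.ofReal (c.likelihood h j v m (a, z))
      ∂(Measure.pi fun _ => gaussianReal 0 1) = 1 := fun m a => by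
    simpa [lintegral_relayDensity c h j hv] using
      c.lintegral_mul_likelihood h j v m a (F := fun _ => 1) measurable_const
  simp only [h1, lintegral_const, measure_univ, mul_one, Finset.sum_const, Finset.card_univ,
    nsmul_eq_mul]
  exact ENNReal.inv_mul_cancel (Nat.cast_ne_zero.2 Fintype.card_ne_zero) (ENNReal.natCast_ne_top _)

/-- The messages of user `j`, the message from `l` to `k`, the user noise and the relay sequence
determine all messages if every user decodes correctly. -/
theorem injOn_correct {j k l : Fin 3} (hjk : j ≠ k) (hjl : j ≠ l) (hkl : k ≠ l)
    (a : Fin 3 → Fin n → ℝ) (y : Fin n → ℝ) :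
    Set.InjOn (fun m : Messages R n => (m j, m l ⟨k, hkl⟩))
      {m | (m, (a, c.relayNoise h m a y)) ∈ c.correct h} := by
  intro m hm m' hm' he
  simp only [Prod.mk.injEq] at he
  -- The decoder of `u` sees only `m u` and a sequence fixed by `a` and `y`.
  have key : ∀ u, m u = m' u → intendedFor m u = intendedFor m' u := by
    intro u hu
    have h1 := hm u
    have h2 := hm' u
    simp only [estimate, received_relayNoise] at h1 h2
    rw [← h1, ← h2, hu]
  have hj := key j he.1
  have hkj : m k ⟨j, hjk⟩ = m' k ⟨j, hjk⟩ := congrFun hj ⟨k, hjk.symm⟩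
  have hlj : m l ⟨j, hjl⟩ = m' l ⟨j, hjl⟩ := congrFun hj ⟨l, hjl.symm⟩
  have hl : m l = m' l := by
    funext ⟨x, hx⟩
    have : x = j ∨ x = k := by omega
    rcases this with rfl | rfl
    · exact hlj
    · exact he.2
  have hkl' : m k ⟨l, hkl.symm⟩ = m' k ⟨l, hkl.symm⟩ := congrFun (key l hl) ⟨k, hkl⟩
  have hk : m k = m' k := by
    funext ⟨x, hx⟩
    have : x = j ∨ x = l := by omega
    rcases this with rfl | rfl
    · exact hkj
    · exact hkl'
  funext x
  have : x = j ∨ x = k ∨ x = l := by omega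
  rcases this with rfl | rfl | rfl
  · exact he.1
  · exact hk
  · exact hl

/-- For each `y`, the correctly decoded `m` inject into the pairs `(m j, m l k)`, and the density
depends only on the first entry. The sum over `m` is thus at most the sum over all pairs, each of
which contributes a density of total mass one. -/
theorem sum_lintegral_correct_le {j k l : Fin 3} (hjk : j ≠ k) (hjl : j ≠ l) (hkl : k ≠ l)
    {v : NNReal} (hv : v ≠ 0) (a : Fin 3 → Fin n → ℝ) :
    ∑ m, ∫⁻ z, (c.correct h).indicator 1 (m, (a, z)) *
        ENNReal.ofReal (c.likelihood h j v m (a, z)) ∂(Measure.pi fun _ => gaussianReal 0 1) ≤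
      Fintype.card (Outgoing R n j × MessageSet R n l ⟨k, hkl⟩) := by
  classical
  have hF : ∀ m, Measurable fun z : Fin n → ℝ =>
      (c.correct h).indicator (1 : Messages R n × Noise n → ℝ≥0∞) (m, (a, z)) := fun m =>
    (measurable_one.indicator (c.measurableSet_correct h)).comp
      (measurable_prodMk_left.comp measurable_prodMk_left)
  have h1 : ∀ m, ∫⁻ z, (c.correct h).indicator 1 (m, (a, z)) *
        ENNReal.ofReal (c.likelihood h j v m (a, z)) ∂(Measure.pi fun _ => gaussianReal 0 1) = _ :=
    fun m => c.lintegral_mul_likelihood h j v m a (hF m)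
  simp_rw [h1]
  have h2 : ∀ m, Measurable fun y => (c.correct h).indicator 1 (m, (a, c.relayNoise h m a y)) *
      c.relayDensity h j v a (m j) y := fun m =>
    ((hF m).comp (c.measurePreserving_relayNoise h m a).measurable).mul
      (c.measurable_relayDensity h j v a (m j))
  rw [← lintegral_finsetSum _ fun m _ => h2 m]
  calc _ ≤ ∫⁻ y, ∑ r : Outgoing R n j × MessageSet R n l ⟨k, hkl⟩,
        c.relayDensity h j v a r.1 y := by
        refine lintegral_mono fun y => ?_
        simp only [Set.indicator_apply, Pi.one_apply, ite_mul, one_mul, zero_mul]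
        rw [← Finset.sum_filter]
        have h2 := c.injOn_correct h hjk hjl hkl a y
        rw [← Finset.sum_image (f := fun r : Outgoing R n j × MessageSet R n l ⟨k, hkl⟩ =>
          c.relayDensity h j v a r.1 y) (g := fun m : Messages R n => (m j, m l ⟨k, hkl⟩))
          fun m hm m' hm' e => h2 (by simpa using hm) (by simpa using hm') e]
        exact Finset.sum_le_sum_of_subset (Finset.subset_univ _)
    _ = _ := by
        rw [lintegral_finsetSum _ fun r _ => c.measurable_relayDensity h j v a r.1]
        simp [lintegral_relayDensity c h j hv]

theorem lintegral_correct_le [Nonempty (Messages R n)] {j k l : Fin 3} (hjk : j ≠ k) (hjl : j ≠ l)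
    (hkl : k ≠ l) {v : NNReal} (hv : v ≠ 0) :
    (Fintype.card (MessageSet R n k ⟨j, hjk⟩) * Fintype.card (MessageSet R n l ⟨j, hjl⟩) *
        Fintype.card (MessageSet R n k ⟨l, hkl.symm⟩) : ℕ) *
      ∫⁻ ω, (c.correct h).indicator 1 ω * ENNReal.ofReal (c.likelihood h j v ω.1 ω.2)
        ∂jointLaw R n ≤ 1 := by
  have hm : Measurable fun ω => (c.correct h).indicator 1 ω *
      ENNReal.ofReal (c.likelihood h j v ω.1 ω.2) :=
    (measurable_one.indicator (c.measurableSet_correct h)).mul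
      (c.measurable_likelihood h j v).ennreal_ofReal
  have hm' : ∀ m, Measurable fun a => ∫⁻ z, (c.correct h).indicator 1 (m, (a, z)) *
      ENNReal.ofReal (c.likelihood h j v m (a, z)) ∂(Measure.pi fun _ => gaussianReal 0 1) :=
    fun m => (hm.comp (measurable_prodMk_left (x := m))).lintegral_prod_right'
  rw [lintegral_jointLaw hm, ← lintegral_finsetSum _ fun m _ => hm' m]
  have h1 : ∫⁻ a, ∑ m, ∫⁻ z, (c.correct h).indicator 1 (m, (a, z)) *
        ENNReal.ofReal (c.likelihood h j v m (a, z)) ∂(Measure.pi fun _ => gaussianReal 0 1)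
        ∂(Measure.pi fun _ => Measure.pi fun _ => gaussianReal 0 1) ≤
      Fintype.card (Outgoing R n j × MessageSet R n l ⟨k, hkl⟩) := by
    refine (lintegral_mono fun a => c.sum_lintegral_correct_le h hjk hjl hkl hv a).trans ?_
    simp
  refine (mul_le_mul_right (mul_le_mul_right h1 _) _).trans ?_
  -- The three counted messages and the pairs known to the genie-aided decoder together make up all
  -- messages.
  rw [mul_left_comm, ← Nat.cast_mul, ← card_messages R n hjk hjl hkl]
  exact (ENNReal.inv_mul_cancel (Nat.cast_ne_zero.2 Fintype.card_ne_zero)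
    (ENNReal.natCast_ne_top _)).le

end Code

/-! ### Second moments of the relay noise and of the residuals -/

section Noise

variable {R : RateTuple} {n : ℕ}

theorem measurePreserving_relayNoise_eval [Nonempty (Messages R n)] (i : Fin n) :
    MeasurePreserving (fun ω : Messages R n × Noise n => ω.2.2 i) (jointLaw R n)
      (gaussianReal 0 1) := by
  have : IsProbabilityMeasure (noiseLaw n) := by unfold noiseLaw; infer_instance
  have : IsProbabilityMeasure (uniformOn (Set.univ : Set (Messages R n))) :=
    isProbabilityMeasure_uniformOn Set.finite_univ Set.univ_nonempty
  have h1 : MeasurePreserving Prod.snd (jointLaw R n) (noiseLaw n) := measurePreserving_snd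
  have h2 : MeasurePreserving Prod.snd (noiseLaw n) (Measure.pi fun _ => gaussianReal 0 1) :=
    measurePreserving_snd
  exact (measurePreserving_eval (fun _ : Fin n => gaussianReal 0 1) i).comp (h2.comp h1)

theorem measurePreserving_negate (i : Fin n) :
    MeasurePreserving (fun ω : Messages R n × Noise n =>
      (ω.1, (ω.2.1, Function.update ω.2.2 i (-ω.2.2 i)))) (jointLaw R n) (jointLaw R n) :=
  (MeasurePreserving.id _).prod ((MeasurePreserving.id _).prod (measurePreserving_update_neg i))

theorem memLp_relayNoise [Nonempty (Messages R n)] (i : Fin n) :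
    MemLp (fun ω : Messages R n × Noise n => ω.2.2 i) 2 (jointLaw R n) :=
  (memLp_id_gaussianReal 2).comp_measurePreserving (measurePreserving_relayNoise_eval i)

theorem integral_relayNoise_sq [Nonempty (Messages R n)] (i : Fin n) :
    ∫ ω : Messages R n × Noise n, ω.2.2 i ^ 2 ∂jointLaw R n = 1 := by
  have h1 := measurePreserving_relayNoise_eval (R := R) i
  have h2 := integral_map (μ := jointLaw R n) h1.measurable.aemeasurable
    (f := fun x : ℝ => x ^ 2) (by fun_prop)
  rw [← h2, h1.map_eq]
  have h3 := variance_of_integral_eq_zero (μ := gaussianReal 0 1) (X := fun x => x)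
    (by fun_prop) (by simp)
  rw [← h3]
  simp

end Noise

namespace Code

variable {R : RateTuple} {n : ℕ} {c : Code R n} {h : Fin 3 → ℝ} {P : ℝ}

theorem PowerConstraint.lintegral_le (hc : c.PowerConstraint h P) (hn : n ≠ 0) (j : Fin 3) :
    ∑ i, ∫⁻ ω, ENNReal.ofReal (c.userSymbol h ω.1 ω.2 j i ^ 2) ∂jointLaw R n ≤
      n * ENNReal.ofReal P :=
  (ENNReal.inv_mul_le_iff (by simpa using hn) (by simp)).1 (hc.1 j)

theorem PowerConstraint.memLp (hc : c.PowerConstraint h P) (hn : n ≠ 0) (j : Fin 3) (i : Fin n) :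
    MemLp (fun ω => c.userSymbol h ω.1 ω.2 j i) 2 (jointLaw R n) := by
  have hm := c.measurable_userSymbol h j i
  rw [memLp_two_iff_integrable_sq hm.aestronglyMeasurable,
    ← lintegral_ofReal_ne_top_iff_integrable (hm.pow_const 2).aestronglyMeasurable
      (ae_of_all _ fun _ => sq_nonneg _)]
  refine ne_top_of_le_ne_top ?_ ((Finset.single_le_sum (f := fun i =>
    ∫⁻ ω, ENNReal.ofReal (c.userSymbol h ω.1 ω.2 j i ^ 2) ∂jointLaw R n) (fun _ _ => zero_le)
    (Finset.mem_univ i)).trans (hc.lintegral_le hn j))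
  exact ENNReal.mul_ne_top (by simp) (by simp)

theorem PowerConstraint.sum_integral_le (hc : c.PowerConstraint h P) (hP : 0 ≤ P) (hn : n ≠ 0)
    (j : Fin 3) : ∑ i, ∫ ω, c.userSymbol h ω.1 ω.2 j i ^ 2 ∂jointLaw R n ≤ n * P := by
  have h1 := hc.lintegral_le hn j
  have h2 : ∀ i, ∫⁻ ω, ENNReal.ofReal (c.userSymbol h ω.1 ω.2 j i ^ 2) ∂jointLaw R n =
      ENNReal.ofReal (∫ ω, c.userSymbol h ω.1 ω.2 j i ^ 2 ∂jointLaw R n) := fun i =>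
    (ofReal_integral_eq_lintegral_ofReal (hc.memLp hn j i).integrable_sq
      (ae_of_all _ fun _ => sq_nonneg _)).symm
  simp_rw [h2] at h1
  rw [← ENNReal.ofReal_sum_of_nonneg fun i _ => integral_nonneg fun _ => sq_nonneg _,
    ← ENNReal.ofReal_natCast, ← ENNReal.ofReal_mul (by positivity)] at h1
  exact (ENNReal.ofReal_le_ofReal_iff (by positivity)).1 h1

/-- Users cannot anticipate the relay noise. -/
theorem integral_userSymbol_mul_noise [Nonempty (Messages R n)] (c : Code R n) (h : Fin 3 → ℝ)
    (j : Fin 3) (i : Fin n) :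
    ∫ ω, c.userSymbol h ω.1 ω.2 j i * ω.2.2 i ∂jointLaw R n = 0 := by
  -- Flipping the sign of the noise at time `i` preserves the law and fixes the symbol, which
  -- depends only on earlier relay noise. The integral therefore equals its own opposite; no
  -- integrability is needed.
  have hT := measurePreserving_negate (R := R) i
  have hm : Measurable fun ω : Messages R n × Noise n =>
      c.userSymbol h ω.1 ω.2 j i * ω.2.2 i :=
    (c.measurable_userSymbol h j i).mul (by fun_prop)
  have h1 := integral_map (μ := jointLaw R n) hT.measurable.aemeasurable
    (f := fun ω : Messages R n × Noise n => c.userSymbol h ω.1 ω.2 j i * ω.2.2 i)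
    hm.aestronglyMeasurable
  rw [hT.map_eq] at h1
  have h2 : ∀ ω : Messages R n × Noise n,
      c.userSymbol h ω.1 (ω.2.1, Function.update ω.2.2 i (-ω.2.2 i)) j i =
        c.userSymbol h ω.1 ω.2 j i := fun ω =>
    c.userSymbol_congr h ω.1 j i fun t ht => by simp [ht.ne]
  simp only [h2, Function.update_self, mul_neg, integral_neg] at h1
  linarith

theorem residual_eq (c : Code R n) (h : Fin 3 → ℝ) {j k l : Fin 3} (hjk : j ≠ k) (hjl : j ≠ l)
    (hkl : k ≠ l) (m : Messages R n) (z : Noise n) (i : Fin n) :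
    c.residual h j m z i =
      h k * c.userSymbol h m z k i + h l * c.userSymbol h m z l i + z.2 i := by
  rw [residual, univ_erase_eq hjk hjl hkl, Finset.sum_pair hkl]

theorem PowerConstraint.memLp_residual [Nonempty (Messages R n)] (hc : c.PowerConstraint h P)
    (hn : n ≠ 0) (j : Fin 3) (i : Fin n) :
    MemLp (fun ω => c.residual h j ω.1 ω.2 i) 2 (jointLaw R n) :=
  (memLp_finsetSum _ fun k _ => (hc.memLp hn k i).const_mul (h k)).add (memLp_relayNoise i)

/-- The symbols of `k` and `l` may be correlated through feedback, so their cross term is bounded by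
`2xy ≤ x² + y²`, whereas the cross terms with the noise vanish. The bound is linear in the
individual powers, so it can be summed over time. -/
theorem PowerConstraint.integral_residual_sq_le [Nonempty (Messages R n)]
    (hc : c.PowerConstraint h P) (hn : n ≠ 0) {j k l : Fin 3} (hjk : j ≠ k) (hjl : j ≠ l)
    (hkl : k ≠ l) (i : Fin n) :
    ∫ ω, c.residual h j ω.1 ω.2 i ^ 2 ∂jointLaw R n ≤
      (|h k| + |h l|) * (|h k| * ∫ ω, c.userSymbol h ω.1 ω.2 k i ^ 2 ∂jointLaw R n +
        |h l| * ∫ ω, c.userSymbol h ω.1 ω.2 l i ^ 2 ∂jointLaw R n) + 1 := by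
  have ik := (hc.memLp hn k i).integrable_sq
  have il := (hc.memLp hn l i).integrable_sq
  have iz := (memLp_relayNoise (R := R) i).integrable_sq
  have ixz : ∀ x, Integrable (fun ω => c.userSymbol h ω.1 ω.2 x i * ω.2.2 i) (jointLaw R n) :=
    fun x => (hc.memLp hn x i).integrable_mul (memLp_relayNoise (R := R) i)
  have i1 : Integrable (fun ω => (|h k| + |h l|) * (|h k| * c.userSymbol h ω.1 ω.2 k i ^ 2 +
      |h l| * c.userSymbol h ω.1 ω.2 l i ^ 2)) (jointLaw R n) :=
    ((ik.const_mul |h k|).add (il.const_mul |h l|)).const_mul (|h k| + |h l|)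
  have i2 : Integrable (fun ω => 2 * h k * (c.userSymbol h ω.1 ω.2 k i * ω.2.2 i) +
      2 * h l * (c.userSymbol h ω.1 ω.2 l i * ω.2.2 i)) (jointLaw R n) :=
    ((ixz k).const_mul (2 * h k)).add ((ixz l).const_mul (2 * h l))
  have i12 : Integrable (fun ω => (|h k| + |h l|) * (|h k| * c.userSymbol h ω.1 ω.2 k i ^ 2 +
      |h l| * c.userSymbol h ω.1 ω.2 l i ^ 2) +
        (2 * h k * (c.userSymbol h ω.1 ω.2 k i * ω.2.2 i) +
          2 * h l * (c.userSymbol h ω.1 ω.2 l i * ω.2.2 i))) (jointLaw R n) := i1.add i2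
  calc _ ≤ ∫ ω, ((|h k| + |h l|) * (|h k| * c.userSymbol h ω.1 ω.2 k i ^ 2 +
        |h l| * c.userSymbol h ω.1 ω.2 l i ^ 2) +
        (2 * h k * (c.userSymbol h ω.1 ω.2 k i * ω.2.2 i) +
          2 * h l * (c.userSymbol h ω.1 ω.2 l i * ω.2.2 i))) + ω.2.2 i ^ 2 ∂jointLaw R n := by
        refine integral_mono (hc.memLp_residual hn j i).integrable_sq (i12.add iz)
          fun ω => ?_
        simp only [c.residual_eq h hjk hjl hkl]
        generalize c.userSymbol h ω.1 ω.2 k i = x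
        generalize c.userSymbol h ω.1 ω.2 l i = y
        have h1 : h k * h l * (2 * x * y) ≤ |h k| * |h l| * (x ^ 2 + y ^ 2) := by
          rw [← abs_mul]
          refine (le_abs_self _).trans ?_
          rw [abs_mul]
          refine mul_le_mul_of_nonneg_left (abs_le.2 ⟨?_, ?_⟩) (abs_nonneg _)
          · linarith [sq_nonneg (x + y)]
          · linarith [sq_nonneg (x - y)]
        have h2 := sq_abs (h k)
        have h3 := sq_abs (h l)
        have h4 : (|h k| + |h l|) * (|h k| * x ^ 2 + |h l| * y ^ 2) =
          |h k| ^ 2 * x ^ 2 + |h l| ^ 2 * y ^ 2 + |h k| * |h l| * (x ^ 2 + y ^ 2) := by ring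
        rw [h4, h2, h3]
        linarith
    _ = _ := by
        rw [integral_add i12 iz, integral_add i1 i2, integral_const_mul,
          integral_add (ik.const_mul _) (il.const_mul _), integral_const_mul, integral_const_mul,
          integral_add ((ixz k).const_mul _) ((ixz l).const_mul _), integral_const_mul,
          integral_const_mul, integral_relayNoise_sq, integral_userSymbol_mul_noise, integral_userSymbol_mul_noise]
        ring

theorem PowerConstraint.sum_integral_residual_sq_le [Nonempty (Messages R n)]
    (hc : c.PowerConstraint h P) (hP : 0 ≤ P) (hn : n ≠ 0) {j k l : Fin 3} (hjk : j ≠ k)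
    (hjl : j ≠ l) (hkl : k ≠ l) :
    ∑ i, ∫ ω, c.residual h j ω.1 ω.2 i ^ 2 ∂jointLaw R n ≤
      n * (1 + (|h k| + |h l|) ^ 2 * P) := by
  refine (Finset.sum_le_sum fun i _ => hc.integral_residual_sq_le hn hjk hjl hkl i).trans ?_
  rw [Finset.sum_add_distrib, ← Finset.mul_sum, Finset.sum_add_distrib, ← Finset.mul_sum,
    ← Finset.mul_sum]
  simp only [Finset.sum_const, Finset.card_univ, Fintype.card_fin, nsmul_eq_mul, mul_one]
  have hk := mul_le_mul_of_nonneg_left (hc.sum_integral_le hP hn k) (abs_nonneg (h k))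
  have hl := mul_le_mul_of_nonneg_left (hc.sum_integral_le hP hn l) (abs_nonneg (h l))
  have := mul_le_mul_of_nonneg_left (add_le_add hk hl)
    (add_nonneg (abs_nonneg (h k)) (abs_nonneg (h l)))
  linarith

/-! ### The expected log-likelihood and the bound at a fixed block length -/

theorem log_likelihood (c : Code R n) (h : Fin 3 → ℝ) (j : Fin 3) {v : NNReal} (hv : v ≠ 0)
    (m : Messages R n) (z : Noise n) :
    Real.log (c.likelihood h j v m z) =
      ∑ i, (-(1 / 2 * Real.log v) - (2 * v : ℝ)⁻¹ * c.residual h j m z i ^ 2 +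
        1 / 2 * z.2 i ^ 2) := by
  have hpdf : ∀ (w : NNReal) (x : ℝ), w ≠ 0 → Real.log (gaussianPDFReal 0 w x) =
      -(1 / 2 * Real.log (2 * Real.pi)) - 1 / 2 * Real.log w - (2 * w : ℝ)⁻¹ * x ^ 2 := by
    intro w x hw
    have hw' : (w : ℝ) ≠ 0 := by exact_mod_cast hw
    have hπ := Real.pi_pos
    have : 0 < 2 * Real.pi * w := by positivity
    rw [gaussianPDFReal, Real.log_mul (by positivity) (by positivity), Real.log_inv,
      Real.log_sqrt this.le, Real.log_exp, Real.log_mul (by positivity) hw']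
    ring
  rw [likelihood, Real.log_prod fun i _ => (div_pos (gaussianPDFReal_pos _ _ _ hv)
    (gaussianPDFReal_pos _ _ _ one_ne_zero)).ne']
  refine Finset.sum_congr rfl fun i _ => ?_
  rw [Real.log_div (gaussianPDFReal_pos _ _ _ hv).ne' (gaussianPDFReal_pos _ _ _ one_ne_zero).ne',
    hpdf _ _ hv, hpdf _ _ one_ne_zero]
  simp only [NNReal.coe_one, Real.log_one]
  ring

theorem PowerConstraint.integrable_log_likelihood [Nonempty (Messages R n)]
    (hc : c.PowerConstraint h P) (hn : n ≠ 0) (j : Fin 3) {v : NNReal} (hv : v ≠ 0) :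
    Integrable (fun ω => Real.log (c.likelihood h j v ω.1 ω.2)) (jointLaw R n) := by
  simp only [log_likelihood c h j hv]
  exact integrable_finsetSum _ fun i _ => ((integrable_const _).sub
    ((hc.memLp_residual hn j i).integrable_sq.const_mul _)).add
      ((memLp_relayNoise i).integrable_sq.const_mul _)

/-- With this `v` the residual terms cost at most `n / 2` in total, exactly what the unit-variance
relay noise contributes, so only the normalising constants remain. -/
theorem PowerConstraint.le_integral_log_likelihood [Nonempty (Messages R n)]
    (hc : c.PowerConstraint h P) (hP : 0 ≤ P) (hn : n ≠ 0) {j k l : Fin 3} (hjk : j ≠ k)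
    (hjl : j ≠ l) (hkl : k ≠ l) {v : NNReal} (hv : (v : ℝ) = 1 + (|h k| + |h l|) ^ 2 * P) :
    -(n / 2 * Real.log v) ≤ ∫ ω, Real.log (c.likelihood h j v ω.1 ω.2) ∂jointLaw R n := by
  have hv1 : (0 : ℝ) < v := by rw [hv]; positivity
  have hv0 : v ≠ 0 := by
    rintro rfl
    simp at hv1
  simp only [log_likelihood c h j hv0]
  have h1 : ∀ i, Integrable (fun ω : Messages R n × Noise n =>
      -(1 / 2 * Real.log v) - (2 * v : ℝ)⁻¹ * c.residual h j ω.1 ω.2 i ^ 2) (jointLaw R n) :=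
    fun i => (integrable_const _).sub ((hc.memLp_residual hn j i).integrable_sq.const_mul _)
  have h2 : ∀ i, Integrable (fun ω : Messages R n × Noise n =>
      (1 / 2 : ℝ) * ω.2.2 i ^ 2) (jointLaw R n) :=
    fun i => (memLp_relayNoise i).integrable_sq.const_mul _
  have h3 : ∀ i : Fin n, ∫ ω, (-(1 / 2 * Real.log v) -
      (2 * v : ℝ)⁻¹ * c.residual h j ω.1 ω.2 i ^ 2 + 1 / 2 * ω.2.2 i ^ 2) ∂jointLaw R n =
      -(1 / 2 * Real.log v) + 1 / 2 -
        (2 * v : ℝ)⁻¹ * ∫ ω, c.residual h j ω.1 ω.2 i ^ 2 ∂jointLaw R n := by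
    intro i
    rw [integral_add (h1 i) (h2 i), integral_sub (integrable_const _)
      ((hc.memLp_residual hn j i).integrable_sq.const_mul _), integral_const_mul,
      integral_const_mul, integral_relayNoise_sq]
    simp
    ring
  have h4 : ∀ i, Integrable (fun ω : Messages R n × Noise n => -(1 / 2 * Real.log v) -
      (2 * v : ℝ)⁻¹ * c.residual h j ω.1 ω.2 i ^ 2 + 1 / 2 * ω.2.2 i ^ 2) (jointLaw R n) :=
    fun i => (h1 i).add (h2 i)
  rw [integral_finsetSum _ fun i _ => h4 i]
  simp_rw [h3]
  rw [Finset.sum_sub_distrib, ← Finset.mul_sum]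
  simp only [Finset.sum_const, Finset.card_univ, Fintype.card_fin, nsmul_eq_mul]
  have h5 := mul_le_mul_of_nonneg_left (hc.sum_integral_residual_sq_le hP hn hjk hjl hkl)
    (inv_nonneg.2 (by positivity : (0 : ℝ) ≤ 2 * v))
  rw [← hv] at h5
  have h6 : (2 * v : ℝ)⁻¹ * (n * v) = n / 2 := by field_simp
  linarith

/-- The converse bound for a single block length. -/
theorem PowerConstraint.mul_log_card_le [Nonempty (Messages R n)] (hc : c.PowerConstraint h P)
    (hP : 0 ≤ P) (hn : n ≠ 0) {j k l : Fin 3} (hjk : j ≠ k) (hjl : j ≠ l) (hkl : k ≠ l) :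
    (1 - (c.errorProb h).toReal) *
        Real.log (Fintype.card (MessageSet R n k ⟨j, hjk⟩) *
          Fintype.card (MessageSet R n l ⟨j, hjl⟩) *
          Fintype.card (MessageSet R n k ⟨l, hkl.symm⟩) : ℕ) ≤
      Real.log 2 + n / 2 * Real.log (1 + (|h k| + |h l|) ^ 2 * P) := by
  set M := Fintype.card (MessageSet R n k ⟨j, hjk⟩) * Fintype.card (MessageSet R n l ⟨j, hjl⟩) *
    Fintype.card (MessageSet R n k ⟨l, hkl.symm⟩) with hMdef
  have hM : M ≠ 0 := by
    intro hM
    have h1 := card_messages R n hjk hjl hkl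
    rw [← hMdef, hM, zero_mul] at h1
    exact Fintype.card_ne_zero h1
  have hM' : (0 : ℝ) < M := by exact_mod_cast Nat.pos_of_ne_zero hM
  obtain ⟨v, hv⟩ : ∃ v : NNReal, (v : ℝ) = 1 + (|h k| + |h l|) ^ 2 * P :=
    ⟨⟨1 + (|h k| + |h l|) ^ 2 * P, by positivity⟩, rfl⟩
  have hv0 : v ≠ 0 := by
    rintro rfl
    have : 0 ≤ (|h k| + |h l|) ^ 2 * P := by positivity
    rw [NNReal.coe_zero] at hv
    linarith
  set μ := jointLaw R n
  set D : Messages R n × Noise n → ℝ := fun ω => c.likelihood h j v ω.1 ω.2 with hD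
  have hDm : Measurable D := c.measurable_likelihood h j v
  have hD0 : ∀ ω, 0 < D ω := fun ω => c.likelihood_pos h j hv0 ω.1 ω.2
  have hE := c.measurableSet_correct h
  have hDl : ∫⁻ ω, ENNReal.ofReal (D ω) ∂μ = 1 := c.lintegral_likelihood h j hv0
  have hDi : Integrable D μ := by
    rw [← lintegral_ofReal_ne_top_iff_integrable hDm.aestronglyMeasurable
      (ae_of_all _ fun ω => (hD0 ω).le), hDl]
    exact ENNReal.one_ne_top
  have hDint : ∫ ω, D ω ∂μ = 1 := by
    rw [integral_eq_lintegral_of_nonneg_ae (ae_of_all _ fun ω => (hD0 ω).le)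
      hDm.aestronglyMeasurable, hDl, ENNReal.toReal_one]
  have hEi : Integrable ((c.correct h).indicator D) μ := hDi.indicator hE
  have hEint : M * ∫ ω, (c.correct h).indicator D ω ∂μ ≤ 1 := by
    have h1 := c.lintegral_correct_le h hjk hjl hkl hv0
    have h2 : ∀ ω, (c.correct h).indicator (1 : Messages R n × Noise n → ℝ≥0∞) ω *
        ENNReal.ofReal (c.likelihood h j v ω.1 ω.2) =
        ENNReal.ofReal ((c.correct h).indicator D ω) := fun ω => by
      by_cases hω : ω ∈ c.correct h <;> simp [hω, hD]
    simp_rw [h2] at h1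
    rw [← ofReal_integral_eq_lintegral_ofReal hEi (ae_of_all _ fun ω =>
      Set.indicator_nonneg (fun ω _ => (hD0 ω).le) ω), ← hMdef, ← ENNReal.ofReal_natCast,
      ← ENNReal.ofReal_mul (by positivity)] at h1
    exact ENNReal.ofReal_le_one.1 h1
  have hLi : Integrable (fun ω => Real.log (D ω)) μ := hc.integrable_log_likelihood hn j hv0
  have hL := hc.le_integral_log_likelihood hP hn hjk hjl hkl hv
  have h1i : Integrable ((c.correct h).indicator fun _ => Real.log M) μ :=
    (integrable_const _).indicator hE
  -- The tangent to the logarithm at `2` is used because `M * 1_E * D + D`, with `E` the correct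
  -- event, has integral at most `2`; the right side then integrates to at most `log 2`.
  have h1 : ∀ ω, Real.log (D ω) + (c.correct h).indicator (fun _ => Real.log M) ω ≤
      1 / 2 * (M * (c.correct h).indicator D ω + D ω) + (Real.log 2 - 1) := by
    intro ω
    have hlog : ∀ x : ℝ, 0 < x → Real.log x ≤ 1 / 2 * x + (Real.log 2 - 1) := fun x hx => by
      have := Real.log_le_sub_one_of_pos (half_pos hx)
      rw [Real.log_div hx.ne' two_ne_zero] at this
      linarith
    by_cases hω : ω ∈ c.correct h
    · simp only [hω, Set.indicator_of_mem]
      rw [← Real.log_mul (hD0 ω).ne' hM'.ne']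
      have := hlog _ (mul_pos (hD0 ω) hM')
      linarith [hD0 ω]
    · simp only [hω, not_false_eq_true, Set.indicator_of_notMem, mul_zero, zero_add, add_zero]
      exact hlog _ (hD0 ω)
  have hri : Integrable (fun ω => 1 / 2 * (M * (c.correct h).indicator D ω + D ω)) μ :=
    ((hEi.const_mul (M : ℝ)).add hDi).const_mul (1 / 2)
  have h2 := integral_mono (hLi.add h1i) (hri.add (integrable_const _)) h1
  have h3 : μ.real (c.correct h) = 1 - (c.errorProb h).toReal := by
    have : (c.errorProb h).toReal = μ.real (c.correct h)ᶜ := by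
      rw [errorProb, measureReal_def]
      congr 2
      ext ω
      simp [correct]
    rw [this, probReal_compl_eq_one_sub hE]
    ring
  simp only [Pi.add_apply] at h2
  rw [integral_add hLi h1i, integral_indicator_const _ hE, h3, smul_eq_mul,
    integral_add hri (integrable_const _),
    integral_const_mul, integral_add (hEi.const_mul (M : ℝ)) hDi, integral_const_mul, hDint,
    integral_const, probReal_univ, one_smul] at h2
  rw [hv] at hL
  linarith

end Code

/-! ### Rounding of the message sets and the limit in the block length -/

/-- A real number that is at least `1` is at most twice its floor, so rounding costs at most one
bit. -/
theorem sub_one_mul_log_two_le_log_floor {x : ℝ} (hx : 0 ≤ x) :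
    (x - 1) * Real.log 2 ≤ Real.log ⌊(2 : ℝ) ^ x⌋₊ := by
  have h1 : (1 : ℝ) ≤ 2 ^ x := Real.one_le_rpow one_le_two hx
  have h2 : (1 : ℝ) ≤ ⌊(2 : ℝ) ^ x⌋₊ := by exact_mod_cast Nat.le_floor (by simpa using h1)
  have h3 := Nat.lt_floor_add_one ((2 : ℝ) ^ x)
  rw [← Real.log_rpow two_pos, Real.rpow_sub_one two_ne_zero]
  exact Real.log_le_log (by positivity) (by linarith)

end YChannel

theorem mainTheorem5 (h : Fin 3 → ℝ) (P : ℝ) (hP : 0 ≤ P)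
    (R : YChannel.RateTuple) (hR : YChannel.Achievable h P R)
    (j k l : Fin 3) (hjk : j ≠ k) (hjl : j ≠ l) (hkl : k ≠ l) :
    R k ⟨j, hjk⟩ + R l ⟨j, hjl⟩ + R k ⟨l, hkl.symm⟩ ≤
      YChannel.gaussianC ((|h k| + |h l|) ^ 2 * P) := by
  obtain ⟨hR0, c, hc, herr⟩ := hR
  set S := R k ⟨j, hjk⟩ + R l ⟨j, hjl⟩ + R k ⟨l, hkl.symm⟩ with hS
  have hpos : ∀ (n : ℕ) a b, 0 < ⌊(2 : ℝ) ^ ((n : ℝ) * R a b)⌋₊ := fun n a b =>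
    Nat.floor_pos.2 (Real.one_le_rpow one_le_two (mul_nonneg n.cast_nonneg (hR0 a b)))
  have hne : ∀ n, Nonempty (YChannel.Messages R n) := fun n =>
    ⟨fun a b => ⟨0, hpos n a b⟩⟩
  have hlog2 : 0 < Real.log 2 := Real.log_pos one_lt_two
  -- The term `3 / n` is one bit of rounding for each of the three messages; the `1 / n` on the
  -- right is the `log 2` of the fixed-length bound.
  have key : ∀ n : ℕ, n ≠ 0 → (1 - ((c n).errorProb h).toReal) * (S - 3 * (n : ℝ)⁻¹) ≤
      (n : ℝ)⁻¹ + YChannel.gaussianC ((|h k| + |h l|) ^ 2 * P) := by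
    intro n hn
    have := hne n
    have hn' : (0 : ℝ) < n := by exact_mod_cast Nat.pos_of_ne_zero hn
    have h1 := (hc n).mul_log_card_le hP hn hjk hjl hkl
    have herr1 : 0 ≤ 1 - ((c n).errorProb h).toReal := by
      have : (c n).errorProb h ≤ 1 := prob_le_one
      have := ENNReal.toReal_mono ENNReal.one_ne_top this
      rw [ENNReal.toReal_one] at this
      linarith
    have hf : ∀ a b, ((n * R a b) - 1) * Real.log 2 ≤
        Real.log (Fintype.card (YChannel.MessageSet R n a b)) := fun a b => by
      rw [Fintype.card_fin]
      exact YChannel.sub_one_mul_log_two_le_log_floor (mul_nonneg n.cast_nonneg (hR0 a b))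
    have hcard : ∀ a b, (Fintype.card (YChannel.MessageSet R n a b) : ℝ) ≠ 0 := fun a b => by
      rw [Fintype.card_fin]
      exact_mod_cast (hpos n a b).ne'
    rw [Nat.cast_mul, Nat.cast_mul, Real.log_mul (mul_ne_zero (hcard _ _) (hcard _ _)) (hcard _ _),
      Real.log_mul (hcard _ _) (hcard _ _)] at h1
    have h2 : (n * Real.log 2) * (S - 3 * (n : ℝ)⁻¹) ≤ _ :=
      le_trans (by rw [hS]; field_simp; linarith)
        (add_le_add (add_le_add (hf k ⟨j, hjk⟩) (hf l ⟨j, hjl⟩)) (hf k ⟨l, hkl.symm⟩))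
    have h3 := (mul_le_mul_of_nonneg_left h2 herr1).trans h1
    rw [mul_left_comm] at h3
    refine le_of_mul_le_mul_left (h3.trans (le_of_eq ?_)) (mul_pos hn' hlog2)
    rw [YChannel.gaussianC, Real.logb]
    field_simp
  have hinv : Tendsto (fun n : ℕ => (n : ℝ)⁻¹) atTop (𝓝 0) := tendsto_inv_atTop_nhds_zero_nat
  have herr' : Tendsto (fun n => ((c n).errorProb h).toReal) atTop (𝓝 0) := by
    simpa [Function.comp_def] using (ENNReal.tendsto_toReal ENNReal.zero_ne_top).comp herr
  have hl : Tendsto (fun n : ℕ => (1 - ((c n).errorProb h).toReal) * (S - 3 * (n : ℝ)⁻¹)) atTop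
      (𝓝 ((1 - 0) * (S - 3 * 0))) :=
    (tendsto_const_nhds.sub herr').mul (tendsto_const_nhds.sub (hinv.const_mul 3))
  have hr := hinv.add_const (YChannel.gaussianC ((|h k| + |h l|) ^ 2 * P))
  have := le_of_tendsto_of_tendsto hl hr ((eventually_ne_atTop 0).mono key)
  simpa using this
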